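/- Let $\gamma$ be Euler's constant and $\zeta'$ the derivative of the Riemann zeta function. For every real $z$ with $0<z<\pi$, the series $\sum_{n\ge1} e^{-nz}\log n$ and $\sum_{k\ge0}\frac{(-1)^k z^k}{k!}\zeta'(-k)$ converge (absolutely), and $$\sum_{n=1}^{\infty} e^{-nz}\log n \;=\; -\frac{\gamma+\log z}{z}\;-\;\sum_{k=0}^{\infty}\frac{(-1)^k z^k}{k!}\,\zeta'(-k).$$ Moreover, the right-hand side is also the asymptotic expansion of the left-hand side as $z\to0^+$: for every integer $N\ge0$, $$\sum_{n=1}^{\infty} e^{-nz}\log n \;=\; -\frac{\gamma+\log z}{z}\;-\;\sum_{k=0}^{N-1}\frac{(-1)^k z^k}{k!}\,\zeta'(-k)\;+\;O(z^N)\qquad (z\to0^+),$$ so this asymptotic expansion is an exact identity on $(0,\pi)$. -/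

import Mathlib

open Filter Topology Asymptotics
open scoped Nat

/-! The identity is the derivative at `s = 0` of `∑ n^(-s) e^{-nz} = Γ(1-s) z^(s-1) + ∑ ζ(s-k)
(-z)^k / k!`: on the left `n^(-s)` yields `-log n`, on the right `Γ'(1) = -γ` yields `(γ + log z) /
z`. For `s = -a < 0` the formula comes from Poisson summation of `x₊^a e^{-zx}`
(`tsum_rpow_mul_exp_eq_tsum_int`): the zero frequency is the Gamma term, and the frequencies `±m`,
expanded binomially in `z / (2πm)`, sum over `m` to `ζ(a+1+k)`, which the functional equation turns
into `ζ(-a-k)`. Both sides are holomorphic for `|s| < 1/2`, so the identity theorem carries the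
formula to `s = 0` (`tsum_cpow_mul_exp_eqOn`), where termwise differentiation is legitimate. This
works for `z < 2π`. The `O(z^N)` statement is then the tail estimate of a power series absolutely
convergent at `z = 1`. -/

/-! ### Laplace transform of `t^p` on the right half-plane. -/

lemma integrableOn_rpow_mul_cexp_neg_mul {p : ℝ} (hp : -1 < p) {r : ℂ} (hr : 0 < r.re) :
    MeasureTheory.IntegrableOn (fun t : ℝ => ((t ^ p : ℝ) : ℂ) * Complex.exp (-(r * t)))
      (Set.Ioi 0) := by
  have h := integrableOn_rpow_mul_exp_neg_mul_rpow hp one_pos hr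
  refine MeasureTheory.Integrable.mono' h ?_ ?_
  · refine Measurable.aestronglyMeasurable ?_
    fun_prop
  · filter_upwards [MeasureTheory.ae_restrict_mem measurableSet_Ioi] with t ht
    have ht : 0 < t := ht
    simp [Complex.norm_exp, abs_of_nonneg (Real.rpow_nonneg ht.le p)]

lemma differentiableOn_laplace_rpow {p : ℝ} (hp : -1 < p) :
    DifferentiableOn ℂ
      (fun r : ℂ => ∫ t in Set.Ioi (0 : ℝ), ((t ^ p : ℝ) : ℂ) * Complex.exp (-(r * t)))
      {r : ℂ | 0 < r.re} := by
  intro r hr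
  have hr : 0 < r.re := hr
  refine (HasDerivAt.differentiableAt (hasDerivAt_integral_of_dominated_loc_of_deriv_le
    (F' := fun r t => ((t ^ p : ℝ) : ℂ) * (Complex.exp (-(r * t)) * (-(1 * t))))
    -- Staying above half of `r.re` gives an exponential bound uniform in `w`.
    (s := {w : ℂ | r.re / 2 < w.re})
    (bound := fun t : ℝ => t ^ (p + 1) * Real.exp (-(r.re / 2) * t ^ (1 : ℝ)))
    ?_ ?_ ?_ ?_ ?_ ?_ ?_).2).differentiableWithinAt
  · exact (isOpen_lt continuous_const Complex.continuous_re).mem_nhds (by simpa using hr)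
  · refine Eventually.of_forall fun w => Measurable.aestronglyMeasurable ?_
    fun_prop
  · exact integrableOn_rpow_mul_cexp_neg_mul hp hr
  · refine Measurable.aestronglyMeasurable ?_
    fun_prop
  · filter_upwards [MeasureTheory.ae_restrict_mem measurableSet_Ioi] with t ht w hw
    have ht : 0 < t := ht
    have hw : r.re / 2 < w.re := hw
    simp only [norm_mul, Complex.norm_real, norm_neg, one_mul, Complex.norm_exp,
      Real.norm_eq_abs, abs_of_pos ht, abs_of_nonneg (Real.rpow_nonneg ht.le p), Real.rpow_one]
    rw [Real.rpow_add ht, Real.rpow_one, mul_assoc, mul_comm t]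
    gcongr
    simp
    nlinarith
  · exact integrableOn_rpow_mul_exp_neg_mul_rpow (by linarith) one_pos (by linarith)
  · refine Eventually.of_forall fun t w _ => ?_
    exact (((hasDerivAt_id w).mul_const (t : ℂ)).neg.cexp).const_mul _

/-- Both sides are holomorphic in `r` and agree for real `r > 0` by the Gamma integral; the identity
theorem is applied at `r = 1`. -/
lemma laplace_rpow {p : ℝ} (hp : -1 < p) {r : ℂ} (hr : 0 < r.re) :
    ∫ t in Set.Ioi (0 : ℝ), ((t ^ p : ℝ) : ℂ) * Complex.exp (-(r * t)) =
      Complex.Gamma (p + 1) * r ^ (-(p + 1) : ℂ) := by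
  have hopen : IsOpen {r : ℂ | 0 < r.re} := isOpen_lt continuous_const Complex.continuous_re
  have hg : DifferentiableOn ℂ (fun r : ℂ => Complex.Gamma (p + 1) * r ^ (-(p + 1) : ℂ))
      {r : ℂ | 0 < r.re} := by
    intro w hw
    exact ((differentiableAt_id.cpow (differentiableAt_const _) (Or.inl hw)).const_mul
      _).differentiableWithinAt
  refine ((differentiableOn_laplace_rpow hp).analyticOnNhd hopen).eqOn_of_preconnected_of_frequently_eq
    (hg.analyticOnNhd hopen) (convex_halfSpace_re_gt 0).isPreconnected
    (show (1 : ℂ) ∈ _ by simp) ?_ hr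
  have key : ∀ x : ℝ, 0 < x →
      ∫ t in Set.Ioi (0 : ℝ), ((t ^ p : ℝ) : ℂ) * Complex.exp (-((x : ℂ) * t)) =
        Complex.Gamma (p + 1) * (x : ℂ) ^ (-(p + 1) : ℂ) := by
    intro x hx
    have h := Complex.integral_cpow_mul_exp_neg_mul_Ioi (a := (p + 1 : ℂ)) (r := x)
      (by simp; linarith) hx
    rw [one_div, Complex.inv_cpow _ _ (by
      rw [Complex.arg_ofReal_of_nonneg hx.le]; exact Real.pi_ne_zero.symm),
      ← Complex.cpow_neg, mul_comm] at h
    rw [← h]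
    refine MeasureTheory.setIntegral_congr_fun measurableSet_Ioi fun t ht => ?_
    have ht : 0 < t := ht
    simp [Complex.ofReal_cpow ht.le]
  have hT : Tendsto (fun x : ℝ => (x : ℂ)) (𝓝[≠] 1) (𝓝[≠] 1) := by
    refine tendsto_nhdsWithin_of_tendsto_nhds_of_eventually_within _ ?_ ?_
    · exact (Complex.continuous_ofReal.tendsto' 1 1 (by simp)).mono_left nhdsWithin_le_nhds
    · filter_upwards [self_mem_nhdsWithin] with x hx
      simpa using hx
  refine hT.frequently (Eventually.frequently ?_)
  filter_upwards [nhdsWithin_le_nhds (lt_mem_nhds one_pos)] with x hx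
  exact key x hx

/-! ### Poisson summation and the Lipschitz formula. -/

open FourierTransform in
lemma fourier_posPart_rpow_mul_exp {a z : ℝ} (ha : 0 < a) (hz : 0 < z) (ξ : ℝ) :
    𝓕 (fun x : ℝ => (((max x 0) ^ a * Real.exp (-(z * x)) : ℝ) : ℂ)) ξ =
      Complex.Gamma (a + 1) * (z + 2 * Real.pi * Complex.I * ξ : ℂ) ^ (-(a + 1) : ℂ) := by
  rw [← laplace_rpow (by linarith) (by simpa using hz), Real.fourier_real_eq_integral_exp_smul,
    ← MeasureTheory.setIntegral_eq_integral_of_forall_compl_eq_zero (s := Set.Ioi (0 : ℝ))]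
  · refine MeasureTheory.setIntegral_congr_fun measurableSet_Ioi fun t ht => ?_
    have ht : 0 < t := ht
    simp only [max_eq_left ht.le, smul_eq_mul, Complex.ofReal_mul, Complex.ofReal_exp]
    rw [mul_left_comm, ← Complex.exp_add]
    congr 2
    push_cast
    ring
  · intro t ht
    have ht : t ≤ 0 := by simpa using ht
    simp [max_eq_right ht, Real.zero_rpow ha.ne']

lemma isBigO_posPart_rpow_mul_exp {a z : ℝ} (ha : 0 < a) (hz : 0 < z) :
    (fun x : ℝ => (((max x 0) ^ a * Real.exp (-(z * x)) : ℝ) : ℂ)) =O[cocompact ℝ]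
      fun x : ℝ => |x| ^ (-2 : ℝ) := by
  rw [cocompact_eq_atBot_atTop, isBigO_sup]
  constructor
  · refine (isBigO_zero _ _).congr' ?_ EventuallyEq.rfl
    filter_upwards [eventually_le_atBot 0] with x hx
    simp [max_eq_right hx, Real.zero_rpow ha.ne']
  · have h := (isLittleO_exp_neg_mul_rpow_atTop hz (-2 - a)).isBigO
    have h2 := (isBigO_refl (fun x : ℝ => x ^ a) atTop).mul h
    rw [← isBigO_norm_left]
    refine h2.congr' ?_ ?_
    · filter_upwards [eventually_ge_atTop 0] with x hx
      rw [Complex.norm_real, Real.norm_eq_abs, max_eq_left hx,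
        abs_of_nonneg (mul_nonneg (Real.rpow_nonneg hx a) (Real.exp_pos _).le), neg_mul]
    · filter_upwards [eventually_gt_atTop 0] with x hx
      rw [abs_of_pos hx, ← Real.rpow_add hx]
      congr 1
      ring

lemma summable_int_add_two_pi_I_mul_cpow {b : ℝ} (hb : 1 < b) (z : ℝ) :
    Summable fun m : ℤ => (z + 2 * Real.pi * Complex.I * m : ℂ) ^ (-b : ℂ) := by
  have h1 := Real.summable_abs_int_rpow hb
  refine summable_of_isBigO h1 (IsBigO.of_bound 1 ?_)
  filter_upwards [(Set.finite_singleton (0 : ℤ)).compl_mem_cofinite] with m hm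
  have hm : m ≠ 0 := by simpa using hm
  have hm' : (0 : ℝ) < |(m : ℝ)| := by positivity
  rw [← Complex.ofReal_neg, Complex.norm_cpow_real, one_mul, Real.norm_eq_abs,
    abs_of_nonneg (Real.rpow_nonneg (abs_nonneg _) _)]
  refine Real.rpow_le_rpow_of_nonpos hm' ?_ (by linarith)
  refine le_trans ?_ (Complex.abs_im_le_norm _)
  simp only [Complex.add_im, Complex.ofReal_im, Complex.mul_im, Complex.mul_re]
  simp [abs_mul, abs_of_pos Real.pi_pos]
  nlinarith [Real.pi_gt_three]

/-- **Lipschitz summation formula** with real exponent. -/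
theorem tsum_rpow_mul_exp_eq_tsum_int {a z : ℝ} (ha : 0 < a) (hz : 0 < z) :
    ∑' n : ℕ, ((((n : ℝ) + 1) ^ a * Real.exp (-(z * ((n : ℝ) + 1))) : ℝ) : ℂ) =
      Complex.Gamma (a + 1) *
        ∑' m : ℤ, (z + 2 * Real.pi * Complex.I * m : ℂ) ^ (-(a + 1) : ℂ) := by
  have hc : Continuous (fun x : ℝ => (((max x 0) ^ a * Real.exp (-(z * x)) : ℝ) : ℂ)) := by
    refine Complex.continuous_ofReal.comp (Continuous.mul ?_ (by fun_prop))
    exact (continuous_id.max continuous_const).rpow_const fun _ => Or.inr ha.le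
  have hS := summable_int_add_two_pi_I_mul_cpow (b := a + 1) (by linarith) z
  push_cast at hS
  have h := Real.tsum_eq_tsum_fourier_of_rpow_decay_of_summable hc one_lt_two
    (isBigO_posPart_rpow_mul_exp ha hz)
    (by simpa only [fourier_posPart_rpow_mul_exp ha hz, Complex.ofReal_intCast]
      using hS.mul_left _) 0
  simp only [fourier_posPart_rpow_mul_exp ha hz, zero_add, Complex.ofReal_intCast,
    QuotientAddGroup.mk_zero, fourier_eval_zero, mul_one] at h
  rw [tsum_mul_left] at h
  rw [← h]
  -- The terms at integers `m ≤ 0` vanish because `0 ^ a = 0`, so the sum over `ℤ` reduces to `m = n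
  -- + 1`.
  have hinj : Function.Injective (fun n : ℕ => ((n : ℤ) + 1)) := fun m n hmn => by simpa using hmn
  rw [← hinj.tsum_eq]
  · refine tsum_congr fun n => ?_
    have : (0 : ℝ) ≤ (n : ℝ) + 1 := by positivity
    push_cast [max_eq_left this]
    rfl
  · intro m hm
    by_contra hcon
    refine hm ?_
    have hm0 : m ≤ 0 := by
      by_contra hlt
      exact hcon ⟨(m - 1).toNat, by simp; omega⟩
    have : (m : ℝ) ≤ 0 := by exact_mod_cast hm0
    simp [max_eq_right this, Real.zero_rpow ha.ne']

/-! ### Binomial expansion of the nonzero frequencies and the functional equation. -/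

lemma Ring.choose_neg_mul_factorial_mul_Gamma {w : ℝ} (hw : 0 < w) (k : ℕ) :
    ((Ring.choose (-w) k : ℝ) : ℂ) * (k ! : ℂ) * Complex.Gamma w =
      (-1) ^ k * Complex.Gamma (w + k) := by
  have hw' : ∀ m : ℕ, (w : ℂ) ≠ -m := fun m h => by
    have := congrArg Complex.re h
    simp at this
    have := Nat.cast_nonneg (α := ℝ) m
    linarith
  have h1 := Complex.Gamma_add_nat_div_Gamma_eq (n := k) (w : ℂ) hw'
  rw [div_eq_iff (Complex.Gamma_ne_zero hw')] at h1
  rw [h1, Complex.ofReal_choose, Complex.ofReal_neg, Ring.choose_neg', ← mul_assoc]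
  congr 1
  have h2 := Ring.factorial_nsmul_multichoose_eq_ascPochhammer (w : ℂ) k
  rw [Polynomial.ascPochhammer_smeval_eq_eval, nsmul_eq_mul] at h2
  rw [← h2, Units.smul_def, Int.coe_negOnePow_natCast, zsmul_eq_mul]
  push_cast
  ring

/-- Factor `y + I = I * (1 - I * y)` and use the binomial series. The logarithm splits without a
`2πi` correction since `1 - I * y` has argument in `(-π/2, π/2)`. -/
lemma hasSum_I_mul_cpow {w y : ℝ} (hy0 : 0 ≤ y) (hy : y < 1) :
    HasSum (fun k : ℕ => ((Ring.choose (-w) k : ℝ) : ℂ) * (y : ℂ) ^ k *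
        Complex.exp (-(Real.pi * (w + k) / 2 * Complex.I)))
      ((y + Complex.I : ℂ) ^ (-w : ℂ)) := by
  have hre : (1 + -(Complex.I * y) : ℂ).re = 1 := by simp
  have h0 : (1 + -(Complex.I * y) : ℂ) ≠ 0 := fun h => by simp [h] at hre
  have hfac : (y + Complex.I : ℂ) = Complex.I * (1 + -(Complex.I * y)) := by
    linear_combination (y : ℂ) * Complex.I_mul_I
  have harg := abs_lt.1 (Complex.abs_arg_lt_pi_div_two_iff.2
    (Or.inl (show 0 < (1 + -(Complex.I * y) : ℂ).re by rw [hre]; norm_num)))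
  have hlog : Complex.log (y + Complex.I) =
      Real.pi / 2 * Complex.I + Complex.log (1 + -(Complex.I * y)) := by
    rw [hfac, Complex.log_mul Complex.I_ne_zero h0, Complex.log_I]
    rw [Complex.arg_I]
    constructor <;> linarith [Real.pi_pos]
  have hne : (y + Complex.I : ℂ) ≠ 0 := by rw [hfac]; exact mul_ne_zero Complex.I_ne_zero h0
  have hs := (Complex.one_add_cpow_hasFPowerSeriesOnBall_zero (a := (-w : ℂ))).hasSum
    (y := -(Complex.I * y)) (by
      rw [mem_eball_zero_iff, ← ofReal_norm]
      simpa [abs_of_nonneg hy0] using hy)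
  have hs' := hs.mul_left (Complex.exp (-(Real.pi * w / 2 * Complex.I)))
  have hval : (y + Complex.I : ℂ) ^ (-w : ℂ) =
      Complex.exp (-(Real.pi * w / 2 * Complex.I)) *
        (1 + (0 + -(Complex.I * y))) ^ (-w : ℂ) := by
    rw [Complex.cpow_def_of_ne_zero hne, hlog, zero_add, Complex.cpow_def_of_ne_zero h0,
      ← Complex.exp_add]
    congr 1
    ring
  rw [hval]
  refine HasSum.congr_fun hs' fun k => ?_
  have hexp : Complex.exp (-(Real.pi * (w + k) / 2 * Complex.I)) =
      Complex.exp (-(Real.pi * w / 2 * Complex.I)) * (-Complex.I) ^ k := by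
    rw [← Complex.exp_neg_pi_div_two_mul_I, ← Complex.exp_nat_mul, ← Complex.exp_add]
    congr 1
    ring
  rw [hexp, binomialSeries_apply, List.ofFn_const, List.prod_replicate, smul_eq_mul,
    Complex.ofReal_choose, Complex.ofReal_neg, ← neg_mul Complex.I, mul_pow]
  ring

/-- The two powers are complex conjugates, so the phases combine into the cosine of the functional
equation. -/
lemma hasSum_add_I_cpow_add_sub_I_cpow {w y : ℝ} (hy0 : 0 ≤ y) (hy : y < 1) :
    HasSum (fun k : ℕ => ((Ring.choose (-w) k : ℝ) : ℂ) * (y : ℂ) ^ k *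
        (2 * Complex.cos (Real.pi * (w + k) / 2)))
      ((y + Complex.I : ℂ) ^ (-w : ℂ) + (y - Complex.I : ℂ) ^ (-w : ℂ)) := by
  have h1 := hasSum_I_mul_cpow (w := w) hy0 hy
  have h2 := (RCLike.hasSum_conj' ℂ).2 h1
  have harg : (y + Complex.I : ℂ).arg ≠ Real.pi := by
    rw [Ne, Complex.arg_eq_pi_iff]
    simp
  have hval : (y - Complex.I : ℂ) ^ (-w : ℂ) =
      (starRingEnd ℂ) ((y + Complex.I : ℂ) ^ (-w : ℂ)) := by
    have h := Complex.conj_cpow _ (-w : ℂ) harg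
    simp only [map_add, Complex.conj_ofReal, Complex.conj_I, map_neg] at h
    rw [sub_eq_add_neg, h]
  rw [hval]
  refine HasSum.congr_fun (h1.add h2) fun k => ?_
  rw [Complex.two_cos, map_mul, map_mul, map_pow, Complex.conj_ofReal, Complex.conj_ofReal,
    ← Complex.exp_conj]
  simp only [map_neg, map_mul, map_div₀, map_add, Complex.conj_ofReal, Complex.conj_I,
    map_natCast, map_ofNat]
  ring_nf

lemma summable_norm_choose_mul_pow (w : ℝ) {y : ℝ} (hy0 : 0 ≤ y) (hy : y < 1) :
    Summable fun k : ℕ => |Ring.choose (-w) k| * y ^ k := by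
  have h := (binomialSeries ℝ (-w)).summable_norm_apply (x := y) (by
      rw [mem_eball_zero_iff]
      refine lt_of_lt_of_le ?_ (binomialSeries_radius_ge_one (𝕂 := ℝ))
      rw [← ofReal_norm]
      simpa [abs_of_nonneg hy0] using hy)
  refine h.congr fun k => ?_
  rw [binomialSeries_apply, List.ofFn_const, List.prod_replicate, smul_eq_mul, norm_mul,
    norm_pow, Real.norm_eq_abs, Real.norm_eq_abs, abs_of_nonneg hy0]

lemma hasSum_two_pi_I_mul_cpow_add {w z : ℝ} (hz : 0 ≤ z) {m : ℕ} (hm : z < 2 * Real.pi * (m + 1)) :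
    HasSum (fun k : ℕ => ((Ring.choose (-w) k : ℝ) : ℂ) * (z : ℂ) ^ k *
        (2 * Real.pi) ^ (-(w + k) : ℂ) * (2 * Complex.cos (Real.pi * (w + k) / 2)) *
        (1 / (m + 1 : ℂ) ^ (w + k : ℂ)))
      ((z + 2 * Real.pi * Complex.I * (m + 1) : ℂ) ^ (-w : ℂ) +
        (z + 2 * Real.pi * Complex.I * (-(m + 1)) : ℂ) ^ (-w : ℂ)) := by
  have hpi := Real.pi_pos
  have hc : 0 < 2 * Real.pi * ((m : ℝ) + 1) := by positivity
  set c : ℝ := 2 * Real.pi * ((m : ℝ) + 1) with hcdef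
  have hc' : (c : ℂ) ≠ 0 := by exact_mod_cast hc.ne'
  have h := (hasSum_add_I_cpow_add_sub_I_cpow (w := w) (div_nonneg hz hc.le)
    ((div_lt_one hc).2 hm)).mul_left ((c : ℂ) ^ (-w : ℂ))
  have hmul : ∀ u : ℂ, u ≠ 0 → (c : ℂ) ^ (-w : ℂ) * u ^ (-w : ℂ) = (c * u) ^ (-w : ℂ) := by
    intro u hu
    rw [Complex.cpow_def_of_ne_zero hc', Complex.cpow_def_of_ne_zero hu,
      Complex.cpow_def_of_ne_zero (mul_ne_zero hc' hu), Complex.log_ofReal_mul hc hu,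
      Complex.ofReal_log hc.le, ← Complex.exp_add]
    ring_nf
  have hne1 : ((z / c : ℝ) + Complex.I : ℂ) ≠ 0 := fun h => by
    simpa using congrArg Complex.im h
  have hne2 : ((z / c : ℝ) - Complex.I : ℂ) ≠ 0 := fun h => by
    simpa using congrArg Complex.im h
  have hval : (c : ℂ) ^ (-w : ℂ) * (((z / c : ℝ) + Complex.I : ℂ) ^ (-w : ℂ) +
      ((z / c : ℝ) - Complex.I : ℂ) ^ (-w : ℂ)) =
      (z + 2 * Real.pi * Complex.I * (m + 1) : ℂ) ^ (-w : ℂ) +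
        (z + 2 * Real.pi * Complex.I * (-(m + 1)) : ℂ) ^ (-w : ℂ) := by
    rw [mul_add, hmul _ hne1, hmul _ hne2]
    congr 2
    · push_cast
      rw [mul_add, mul_div_cancel₀ _ hc', hcdef]
      push_cast
      ring
    · push_cast
      rw [mul_sub, mul_div_cancel₀ _ hc', hcdef]
      push_cast
      ring
  rw [hval] at h
  refine h.congr_fun fun k => ?_
  have hpow : (2 * Real.pi : ℂ) ^ (-(w + k) : ℂ) * (1 / (m + 1 : ℂ) ^ (w + k : ℂ)) =
      (c : ℂ) ^ (-w : ℂ) * (1 / (c : ℂ) ^ k) := by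
    rw [one_div, ← Complex.cpow_neg, one_div, ← Complex.cpow_natCast (c : ℂ),
      ← Complex.cpow_neg, ← Complex.cpow_add _ _ hc', hcdef]
    have h1 := Complex.mul_cpow_ofReal_nonneg (a := 2 * Real.pi) (b := m + 1) (by positivity)
      (by positivity) (-(w + k) : ℂ)
    push_cast at h1 ⊢
    rw [← h1]
    ring_nf
  calc _ = ((Ring.choose (-w) k : ℝ) : ℂ) * (z : ℂ) ^ k *
        (2 * Complex.cos (Real.pi * (w + k) / 2)) *
        ((2 * Real.pi : ℂ) ^ (-(w + k) : ℂ) * (1 / (m + 1 : ℂ) ^ (w + k : ℂ))) := by ring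
    _ = _ := by
      rw [hpow]
      push_cast
      rw [div_pow]
      ring

/-- Absolute convergence justifying the exchange of sums: the terms are dominated by a product of `1
/ (n+1)^w` and the binomial series at `z / (2π) < 1`. -/
lemma summable_choose_mul_two_pi_cpow {w z : ℝ} (hw : 1 < w) (hz0 : 0 ≤ z)
    (hz : z < 2 * Real.pi) :
    Summable (fun x : ℕ × ℕ => ((Ring.choose (-w) x.2 : ℝ) : ℂ) * (z : ℂ) ^ x.2 *
        (2 * Real.pi) ^ (-(w + x.2) : ℂ) * (2 * Complex.cos (Real.pi * (w + x.2) / 2)) *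
        (1 / (x.1 + 1 : ℂ) ^ (w + x.2 : ℂ))) := by
  have hpi := Real.pi_pos
  have h1 : Summable fun n : ℕ => 1 / ((n : ℝ) + 1) ^ w := by
    simpa using (summable_nat_add_iff 1).2 (Real.summable_one_div_nat_rpow.2 hw)
  have h2 := ((summable_norm_choose_mul_pow w (div_nonneg hz0 (by positivity))
    ((div_lt_one (by positivity)).2 hz)).mul_left (2 * (2 * Real.pi) ^ (-w)))
  refine Summable.of_norm_bounded (h1.mul_of_nonneg h2 (fun n => by positivity)
    (fun k => by positivity)) ?_
  rintro ⟨n, k⟩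
  have e1 : ‖(2 * Real.pi : ℂ) ^ (-(w + k) : ℂ)‖ = (2 * Real.pi) ^ (-w) / (2 * Real.pi) ^ k := by
    have := Complex.norm_cpow_eq_rpow_re_of_pos (x := 2 * Real.pi) (by positivity)
      (-(w + k) : ℂ)
    push_cast at this
    rw [this, ← Real.rpow_natCast, ← Real.rpow_sub (by positivity)]
    congr 1
    simp
    ring
  have e2 : ‖(1 / (n + 1 : ℂ) ^ (w + k : ℂ))‖ ≤ 1 / ((n : ℝ) + 1) ^ w := by
    have := Complex.norm_cpow_eq_rpow_re_of_pos (x := (n : ℝ) + 1) (by positivity)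
      (w + k : ℂ)
    push_cast at this
    rw [norm_div, norm_one, this]
    refine one_div_le_one_div_of_le (by positivity) ?_
    exact Real.rpow_le_rpow_of_exponent_le (by linarith [Nat.cast_nonneg (α := ℝ) n]) (by simp)
  have e3 : ‖Complex.cos (Real.pi * (w + k) / 2)‖ ≤ 1 := by
    have : Complex.cos (Real.pi * (w + k) / 2) = ((Real.cos (Real.pi * (w + k) / 2) : ℝ) : ℂ) := by
      push_cast; rfl
    rw [this, Complex.norm_real]
    exact Real.abs_cos_le_one _
  simp only [norm_mul, norm_pow, Complex.norm_real, e1, Real.norm_eq_abs, abs_of_nonneg hz0]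
  rw [mul_comm (1 / ((n : ℝ) + 1) ^ w)]
  refine mul_le_mul ?_ e2 (norm_nonneg _) (by positivity)
  calc _ ≤ |Ring.choose (-w) k| * z ^ k * ((2 * Real.pi) ^ (-w) / (2 * Real.pi) ^ k) * (2 * 1) := by
        gcongr
        simp
    _ = _ := by
        rw [div_pow]
        ring

lemma tsum_int_two_pi_I_mul_cpow {w z : ℝ} (hw : 1 < w) :
    ∑' m : ℤ, (z + 2 * Real.pi * Complex.I * m : ℂ) ^ (-w : ℂ) =
      (z : ℂ) ^ (-w : ℂ) + ∑' m : ℕ,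
        ((z + 2 * Real.pi * Complex.I * (m + 1) : ℂ) ^ (-w : ℂ) +
          (z + 2 * Real.pi * Complex.I * (-(m + 1)) : ℂ) ^ (-w : ℂ)) := by
  have hS := summable_int_add_two_pi_I_mul_cpow hw z
  -- The summand is made opaque so that rewriting sees only its integer argument.
  obtain ⟨f, hf⟩ : ∃ f : ℤ → ℂ, ∀ m : ℤ, (z + 2 * Real.pi * Complex.I * m : ℂ) ^ (-w : ℂ) = f m :=
    ⟨_, fun _ => rfl⟩
  have hf0 := hf 0
  have hf1 : ∀ m : ℕ, (z + 2 * Real.pi * Complex.I * (m + 1) : ℂ) ^ (-w : ℂ) = f (m + 1) :=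
    fun m => by simpa using hf (m + 1)
  have hf2 : ∀ m : ℕ, (z + 2 * Real.pi * Complex.I * (-(m + 1)) : ℂ) ^ (-w : ℂ) = f (-(m + 1)) :=
    fun m => by rw [← hf]; push_cast; rfl
  rw [Int.cast_zero, mul_zero, add_zero] at hf0
  simp only [hf, hf1, hf2, hf0] at hS ⊢
  have h1 : Summable fun n : ℕ => f (n + 1) := hS.comp_injective fun m n h => by simpa using h
  have h2 : Summable fun n : ℕ => f (-(n + 1)) := hS.comp_injective fun m n h => by simpa using h
  rw [tsum_of_add_one_of_neg_add_one h1 h2, h1.tsum_add h2]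
  ring

lemma Gamma_mul_choose_mul_zeta {w : ℝ} (hw : 1 < w) (z : ℂ) (k : ℕ) :
    Complex.Gamma w * (((Ring.choose (-w) k : ℝ) : ℂ) * z ^ k *
        (2 * Real.pi) ^ (-(w + k) : ℂ) * (2 * Complex.cos (Real.pi * (w + k) / 2)) *
        riemannZeta (w + k)) =
      (-1 : ℂ) ^ k * z ^ k / (k ! : ℂ) * riemannZeta (1 - w - k) := by
  have hFE := riemannZeta_one_sub (s := (w + k : ℂ))
    (fun n h => by
      have := congrArg Complex.re h
      simp at this
      linarith [Nat.cast_nonneg (α := ℝ) k, Nat.cast_nonneg (α := ℝ) n])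
    (fun h => by
      have := congrArg Complex.re h
      simp at this
      linarith [Nat.cast_nonneg (α := ℝ) k])
  have hch := Ring.choose_neg_mul_factorial_mul_Gamma (w := w) (by linarith) k
  have hk : (k ! : ℂ) ≠ 0 := by exact_mod_cast k.factorial_ne_zero
  rw [sub_sub, hFE, div_mul_eq_mul_div, eq_div_iff hk]
  linear_combination z ^ k * (2 * Real.pi) ^ (-(w + k) : ℂ) *
    (2 * Complex.cos (Real.pi * (w + k) / 2)) * riemannZeta (w + k) * hch

lemma Gamma_mul_tsum_tsum_choose {w z : ℝ} (hw : 1 < w) (hz0 : 0 ≤ z) (hz : z < 2 * Real.pi) :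
    Complex.Gamma w * ∑' m : ℕ, ∑' k : ℕ, (((Ring.choose (-w) k : ℝ) : ℂ) * (z : ℂ) ^ k *
        (2 * Real.pi) ^ (-(w + k) : ℂ) * (2 * Complex.cos (Real.pi * (w + k) / 2)) *
        (1 / (m + 1 : ℂ) ^ (w + k : ℂ))) =
        ∑' k : ℕ, (-1 : ℂ) ^ k * (z : ℂ) ^ k / (k ! : ℂ) * riemannZeta (1 - w - k) := by
  have h := Summable.tsum_comm (f := fun m k : ℕ => (((Ring.choose (-w) k : ℝ) : ℂ) * (z : ℂ) ^ k *
        (2 * Real.pi) ^ (-(w + k) : ℂ) * (2 * Complex.cos (Real.pi * (w + k) / 2)) *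
        (1 / (m + 1 : ℂ) ^ (w + k : ℂ)))) (summable_choose_mul_two_pi_cpow hw hz0 hz)
  rw [← h, ← tsum_mul_left]
  refine tsum_congr fun k => ?_
  rw [tsum_mul_left, ← Gamma_mul_choose_mul_zeta hw,
    zeta_eq_tsum_one_div_nat_add_one_cpow (s := (w + k : ℂ)) (by
    simp; linarith [Nat.cast_nonneg (α := ℝ) k])]

/-- Expansion of `∑ nᵃ e^{-nz}` for `a > 0` in terms of zeta values. -/
theorem tsum_rpow_mul_exp_eq_zeta {a z : ℝ} (ha : 0 < a) (hz0 : 0 < z) (hz : z < 2 * Real.pi) :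
    ∑' n : ℕ, ((((n : ℝ) + 1) ^ a * Real.exp (-(z * ((n : ℝ) + 1))) : ℝ) : ℂ) =
      Complex.Gamma (a + 1) * (z : ℂ) ^ (-(a + 1) : ℂ) +
        ∑' k : ℕ, (-1 : ℂ) ^ k * (z : ℂ) ^ k / (k ! : ℂ) * riemannZeta (-a - k) := by
  rw [tsum_rpow_mul_exp_eq_tsum_int ha hz0]
  obtain ⟨w, hwa⟩ : ∃ w : ℝ, w = a + 1 := ⟨_, rfl⟩
  have hw : 1 < w := by linarith
  have hwc : (a + 1 : ℂ) = w := by rw [hwa]; push_cast; rfl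
  have hac : (-a : ℂ) = 1 - w := by rw [hwa]; push_cast; ring
  have hm : ∀ m : ℕ, z < 2 * Real.pi * (m + 1) := fun m => by
    nlinarith [Real.pi_pos, Nat.cast_nonneg (α := ℝ) m]
  rw [hwc, hac, tsum_int_two_pi_I_mul_cpow hw, mul_add]
  congr 1
  rw [tsum_congr fun m => (hasSum_two_pi_I_mul_cpow_add (w := w) hz0.le (hm m)).tsum_eq.symm]
  exact Gamma_mul_tsum_tsum_choose hw hz0.le hz

/-! ### Bounds uniform in `s` near `0`. -/

lemma norm_Gamma_add_nat_le {C : ℝ} {u : ℂ} (hC : ‖Complex.Gamma u‖ ≤ C) (hu0 : 0 < u.re)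
    (hu : ‖u‖ ≤ 2) (k : ℕ) : ‖Complex.Gamma (u + k)‖ ≤ C * (k + 1)! := by
  induction k with
  | zero => simpa using hC
  | succ k ih =>
    have hne : u + k ≠ 0 := fun h => by
      have := congrArg Complex.re h
      simp at this
      linarith [Nat.cast_nonneg (α := ℝ) k]
    have hC0 : 0 ≤ C := (norm_nonneg _).trans hC
    have hk : ‖u + k‖ ≤ (k + 1 + 1 : ℕ) := by
      refine (norm_add_le _ _).trans ?_
      rw [Complex.norm_natCast]
      push_cast
      linarith
    rw [Nat.cast_succ, ← add_assoc, Complex.Gamma_add_one _ hne, norm_mul, Nat.factorial_succ (k + 1)]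
    calc _ ≤ ((k + 1 + 1 : ℕ) : ℝ) * (C * (k + 1)!) := by gcongr
      _ = _ := by push_cast; ring

lemma Complex.norm_cos_le_exp_abs_im (x : ℂ) : ‖Complex.cos x‖ ≤ Real.exp |x.im| := by
  have h : ‖2 * Complex.cos x‖ ≤ Real.exp |x.im| + Real.exp |x.im| := by
    rw [Complex.two_cos]
    refine (norm_add_le _ _).trans (add_le_add ?_ ?_) <;> rw [Complex.norm_exp]
    · simpa using neg_le_abs x.im
    · simpa using le_abs_self x.im
  rw [norm_mul] at h
  simp at h
  linarith

lemma norm_riemannZeta_le_of_le_re {σ : ℝ} (hσ : 1 < σ) {s : ℂ} (hs : σ ≤ s.re) :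
    ‖riemannZeta s‖ ≤ ∑' n : ℕ, 1 / ((n : ℝ) + 1) ^ σ := by
  have h1 : Summable fun n : ℕ => 1 / ((n : ℝ) + 1) ^ σ := by
    simpa using (summable_nat_add_iff 1).2 (Real.summable_one_div_nat_rpow.2 hσ)
  rw [zeta_eq_tsum_one_div_nat_add_one_cpow (by linarith)]
  refine tsum_of_norm_bounded h1.hasSum fun n => ?_
  have := Complex.norm_cpow_eq_rpow_re_of_pos (x := (n : ℝ) + 1) (by positivity) s
  push_cast at this
  rw [norm_div, norm_one, this]
  exact one_div_le_one_div_of_le (by positivity)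
    (Real.rpow_le_rpow_of_exponent_le (by linarith [Nat.cast_nonneg (α := ℝ) n]) hs)

/-- For `k ≥ 1` the functional equation reflects `s - k` to `1 - s + k`, of real part at least
`3/2`, where zeta is bounded; `k = 0` is covered by compactness. The factor `(2π)^(-k)` is what
gives convergence for `z < 2π`. -/
lemma exists_norm_riemannZeta_sub_nat_le :
    ∃ C : ℝ, 0 ≤ C ∧ ∀ k : ℕ, ∀ s ∈ Metric.ball (0 : ℂ) (1 / 2),
      ‖riemannZeta (s - k)‖ ≤ C * (k + 1)! / (2 * Real.pi) ^ k := by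
  have hpi := Real.pi_pos
  obtain ⟨A, hA⟩ := (isCompact_closedBall (0 : ℂ) (1 / 2)).exists_bound_of_continuousOn
    (f := riemannZeta) fun s hs => (differentiableAt_riemannZeta (by
      rintro rfl
      norm_num at hs)).continuousAt.continuousWithinAt
  obtain ⟨B, hB⟩ := (isCompact_closedBall (0 : ℂ) (1 / 2)).exists_bound_of_continuousOn
    (f := fun s => Complex.Gamma (1 - s)) fun s hs => by
      refine ContinuousAt.continuousWithinAt ?_
      refine ContinuousAt.comp (f := fun s : ℂ => 1 - s) (g := Complex.Gamma) ?_ (by fun_prop)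
      refine (Complex.differentiableAt_Gamma _ fun m hm => ?_).continuousAt
      have h1 := (Complex.abs_re_le_norm s).trans (by simpa using hs)
      have := congrArg Complex.re hm
      simp at this
      have := abs_le.1 h1
      linarith [Nat.cast_nonneg (α := ℝ) m]
  have hA0 : 0 ≤ A := (norm_nonneg _).trans (hA 0 (by simp))
  have hB0 : 0 ≤ B := (norm_nonneg _).trans (hB 0 (by simp))
  obtain ⟨Z, hZ⟩ : ∃ Z : ℝ, ∀ s : ℂ, 3 / 2 ≤ s.re → ‖riemannZeta s‖ ≤ Z :=
    ⟨_, fun s hs => norm_riemannZeta_le_of_le_re (σ := 3 / 2) (by norm_num) hs⟩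
  have hZ0 : 0 ≤ Z := (norm_nonneg _).trans (hZ 2 (by norm_num))
  refine ⟨A + 2 * B * Real.exp Real.pi * Z, by positivity, fun k s hs => ?_⟩
  have hs' : ‖s‖ < 1 / 2 := by simpa using hs
  have hre := abs_lt.1 ((Complex.abs_re_le_norm s).trans_lt hs')
  have him := (Complex.abs_im_le_norm s).trans_lt hs'
  rcases Nat.eq_zero_or_pos k with rfl | hk
  · have := hA s (Metric.ball_subset_closedBall hs)
    have : 0 ≤ 2 * B * Real.exp Real.pi * Z := by positivity
    simp
    linarith
  have hk1 : (1 : ℝ) ≤ k := by exact_mod_cast hk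
  have hFE := riemannZeta_one_sub (s := 1 - s + k)
    (fun n h => by
      have := congrArg Complex.re h
      simp at this
      linarith [Nat.cast_nonneg (α := ℝ) n])
    (fun h => by
      have := congrArg Complex.re h
      simp at this
      linarith)
  rw [show (s - k : ℂ) = 1 - (1 - s + k) by ring, hFE, norm_mul, norm_mul, norm_mul, norm_mul,
    Complex.norm_ofNat]
  have e1 : ‖(2 * Real.pi : ℂ) ^ (-(1 - s + k))‖ ≤ 1 / (2 * Real.pi) ^ k := by
    have := Complex.norm_cpow_eq_rpow_re_of_pos (x := 2 * Real.pi) (by positivity) (-(1 - s + k))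
    push_cast at this
    rw [this, ← Real.rpow_natCast, one_div, ← Real.rpow_neg (by positivity)]
    refine Real.rpow_le_rpow_of_exponent_le (by linarith [Real.pi_gt_three]) ?_
    simp
    linarith
  have e2 : ‖Complex.Gamma (1 - s + k)‖ ≤ B * (k + 1)! := by
    refine norm_Gamma_add_nat_le (hB s (Metric.ball_subset_closedBall hs)) ?_ ?_ k
    · simp; linarith
    · refine (norm_sub_le _ _).trans ?_
      rw [norm_one]; linarith
  have e3 : ‖Complex.cos (Real.pi * (1 - s + k) / 2)‖ ≤ Real.exp Real.pi := by
    refine (Complex.norm_cos_le_exp_abs_im _).trans (Real.exp_le_exp.2 ?_)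
    have : (Real.pi * (1 - s + k) / 2 : ℂ).im = Real.pi * (-s.im / 2) := by
      simp
      ring
    rw [this, abs_mul, abs_of_pos hpi, abs_div, abs_neg, abs_two]
    nlinarith
  have e4 : ‖riemannZeta (1 - s + k)‖ ≤ Z := by
    refine hZ _ ?_
    simp
    linarith
  calc _ ≤ 2 * (1 / (2 * Real.pi) ^ k) * (B * (k + 1)!) * Real.exp Real.pi * Z := by gcongr
    -- The explicit `0` is then compared with `A`, the constant for `k = 0`.
    _ = (0 + 2 * B * Real.exp Real.pi * Z) * (k + 1)! / (2 * Real.pi) ^ k := by ring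
    _ ≤ _ := by gcongr

lemma exists_summable_bound_zeta_terms {z : ℝ} (hz0 : 0 < z) (hz : z < 2 * Real.pi) :
    ∃ u : ℕ → ℝ, Summable u ∧ ∀ k : ℕ, ∀ s ∈ Metric.ball (0 : ℂ) (1 / 2),
      ‖(-1 : ℂ) ^ k * (z : ℂ) ^ k / (k ! : ℂ) * riemannZeta (s - k)‖ ≤ u k := by
  obtain ⟨C, hC0, hC⟩ := exists_norm_riemannZeta_sub_nat_le
  have hpi := Real.pi_pos
  have hr : ‖z / (2 * Real.pi)‖ < 1 := by
    rw [Real.norm_of_nonneg (by positivity)]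
    exact (div_lt_one (by positivity)).2 hz
  have h1 := summable_pow_mul_geometric_of_norm_lt_one 1 hr
  have h0 := summable_geometric_of_norm_lt_one hr
  refine ⟨fun k => C * ((k : ℝ) ^ 1 * (z / (2 * Real.pi)) ^ k + (z / (2 * Real.pi)) ^ k),
    (h1.add h0).mul_left C, fun k s hs => ?_⟩
  have hk : (0 : ℝ) < k ! := by exact_mod_cast k.factorial_pos
  rw [norm_mul, norm_div, norm_mul, norm_pow, norm_pow, norm_neg, norm_one, one_pow, one_mul,
    Complex.norm_real, Real.norm_of_nonneg hz0.le, Complex.norm_natCast]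
  calc _ ≤ z ^ k / k ! * (C * (k + 1)! / (2 * Real.pi) ^ k) := by
        gcongr
        exact hC k s hs
    _ = _ := by
        simp only [Nat.factorial_succ, div_pow]
        push_cast
        field_simp

lemma exists_summable_bound_cpow_exp {z : ℝ} (hz0 : 0 < z) :
    ∃ u : ℕ → ℝ, Summable u ∧ ∀ n : ℕ, ∀ s ∈ Metric.ball (0 : ℂ) (1 / 2),
      ‖(Real.exp (-((n : ℝ) + 1) * z) : ℂ) * ((n : ℂ) + 1) ^ (-s)‖ ≤ u n := by
  have h := (summable_nat_add_iff 1).2 (Real.summable_pow_mul_exp_neg_nat_mul 1 hz0)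
  refine ⟨_, h, fun n s hs => ?_⟩
  have hs' : ‖s‖ < 1 / 2 := by simpa using hs
  have hre := abs_lt.1 ((Complex.abs_re_le_norm s).trans_lt hs')
  have := Complex.norm_cpow_eq_rpow_re_of_pos (x := (n : ℝ) + 1) (by positivity) (-s)
  push_cast at this
  rw [norm_mul, this, Complex.norm_real, Real.norm_of_nonneg (Real.exp_pos _).le, mul_comm]
  push_cast
  rw [mul_comm (-z), neg_mul_comm]
  refine mul_le_mul_of_nonneg_right ?_ (Real.exp_pos _).le
  rw [← Real.rpow_natCast]
  refine Real.rpow_le_rpow_of_exponent_le (by linarith [Nat.cast_nonneg (α := ℝ) n]) ?_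
  simp
  linarith

/-! ### Continuation in `s` to a disc around `0`. -/

lemma differentiableOn_zeta_term (z : ℂ) (k : ℕ) :
    DifferentiableOn ℂ (fun s : ℂ => (-1 : ℂ) ^ k * z ^ k / (k ! : ℂ) * riemannZeta (s - k))
      (Metric.ball 0 (1 / 2)) := by
  intro s hs
  have hs' : ‖s‖ < 1 / 2 := by simpa using hs
  have hre := abs_lt.1 ((Complex.abs_re_le_norm s).trans_lt hs')
  refine (DifferentiableAt.const_mul ?_ _).differentiableWithinAt
  refine (differentiableAt_riemannZeta fun h => ?_).comp (f := fun s : ℂ => s - k) s (by fun_prop)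
  have := congrArg Complex.re h
  simp at this
  linarith [Nat.cast_nonneg (α := ℝ) k]

lemma differentiable_exp_mul_cpow (z : ℝ) (n : ℕ) :
    Differentiable ℂ
      fun s : ℂ => (Real.exp (-((n : ℝ) + 1) * z) : ℂ) * ((n : ℂ) + 1) ^ (-s) := by
  intro s
  refine DifferentiableAt.const_mul (DifferentiableAt.const_cpow (by fun_prop) (Or.inl ?_)) _
  exact_mod_cast n.succ_ne_zero

lemma differentiableOn_Gamma_one_sub_mul_cpow {z : ℝ} (hz0 : 0 < z) :
    DifferentiableOn ℂ (fun s : ℂ => Complex.Gamma (1 - s) * (z : ℂ) ^ (s - 1))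
      (Metric.ball 0 (1 / 2)) := by
  intro s hs
  have hs' : ‖s‖ < 1 / 2 := by simpa using hs
  have hre := abs_lt.1 ((Complex.abs_re_le_norm s).trans_lt hs')
  refine (DifferentiableAt.mul ?_ (DifferentiableAt.const_cpow (by fun_prop)
    (Or.inl (by exact_mod_cast hz0.ne')))).differentiableWithinAt
  refine (Complex.differentiableAt_Gamma _ fun m h => ?_).comp (f := fun s : ℂ => 1 - s) s
    (by fun_prop)
  have := congrArg Complex.re h
  simp at this
  linarith [Nat.cast_nonneg (α := ℝ) m]

/-- The expansion `Li_s(e^{-z}) = Γ(1 - s) z^{s-1} + ∑ ζ(s - k) (-z)^k / k!` near `s = 0`. -/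
theorem tsum_cpow_mul_exp_eqOn {z : ℝ} (hz0 : 0 < z) (hz : z < 2 * Real.pi) :
    Set.EqOn
      (fun s : ℂ => ∑' n : ℕ, (Real.exp (-((n : ℝ) + 1) * z) : ℂ) * ((n : ℂ) + 1) ^ (-s))
      (fun s : ℂ => Complex.Gamma (1 - s) * (z : ℂ) ^ (s - 1) +
        ∑' k : ℕ, (-1 : ℂ) ^ k * (z : ℂ) ^ k / (k ! : ℂ) * riemannZeta (s - k))
      (Metric.ball 0 (1 / 2)) := by
  obtain ⟨u, hu, hub⟩ := exists_summable_bound_zeta_terms hz0 hz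
  obtain ⟨v, hv, hvb⟩ := exists_summable_bound_cpow_exp hz0
  have hL := Complex.differentiableOn_tsum_of_summable_norm hv
    (fun n => (differentiable_exp_mul_cpow z n).differentiableOn) Metric.isOpen_ball hvb
  have hR := (differentiableOn_Gamma_one_sub_mul_cpow hz0).add
    (Complex.differentiableOn_tsum_of_summable_norm hu
      (differentiableOn_zeta_term z) Metric.isOpen_ball hub)
  -- The formula is known only for real `s < 0`, so the accumulation point must be a negative point
  -- of the disc; `-1/4` is one.
  refine (hL.analyticOnNhd Metric.isOpen_ball).eqOn_of_preconnected_of_frequently_eq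
    (hR.analyticOnNhd Metric.isOpen_ball) (convex_ball _ _).isPreconnected
    (z₀ := ((-(1 / 4) : ℝ) : ℂ)) ?_ ?_
  · rw [mem_ball_zero_iff, Complex.norm_real]
    norm_num
  · have hT : Tendsto (fun x : ℝ => (x : ℂ)) (𝓝[≠] (-(1 / 4))) (𝓝[≠] ((-(1 / 4) : ℝ) : ℂ)) := by
      refine tendsto_nhdsWithin_of_tendsto_nhds_of_eventually_within _ ?_ ?_
      · exact (Complex.continuous_ofReal.tendsto _).mono_left nhdsWithin_le_nhds
      · filter_upwards [self_mem_nhdsWithin] with x hx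
        exact fun h => hx (Complex.ofReal_injective h)
    refine hT.frequently (Eventually.frequently ?_)
    filter_upwards [nhdsWithin_le_nhds (gt_mem_nhds (show (-(1 / 4) : ℝ) < 0 by norm_num))] with x hx
    have h := tsum_rpow_mul_exp_eq_zeta (a := -x) (by linarith) hz0 hz
    push_cast at h
    simp only [neg_neg, neg_add_eq_sub] at h
    simp only [neg_sub] at h ⊢
    rw [← h]
    refine tsum_congr fun n => ?_
    have hn : (0 : ℝ) ≤ (n : ℝ) + 1 := by positivity
    rw [Complex.ofReal_cpow hn]
    push_cast
    rw [mul_comm]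
    ring_nf

/-! ### Differentiation at `s = 0`. -/

lemma hasDerivAt_Gamma_one_sub_mul_cpow {z : ℝ} (hz0 : 0 < z) :
    HasDerivAt (fun s : ℂ => Complex.Gamma (1 - s) * (z : ℂ) ^ (s - 1))
      (((Real.eulerMascheroniConstant + Real.log z) / z : ℝ) : ℂ) 0 := by
  have hzc : (z : ℂ) ≠ 0 := by exact_mod_cast hz0.ne'
  have h1 : HasDerivAt (fun s : ℂ => Complex.Gamma (1 - s))
      (-(-(Real.eulerMascheroniConstant : ℂ))) 0 :=
    HasDerivAt.comp_const_sub (f := Complex.Gamma) 1 0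
      (by simpa using Complex.hasDerivAt_Gamma_one)
  have h2 := ((hasDerivAt_id (0 : ℂ)).sub_const 1).const_cpow (c := (z : ℂ)) (Or.inl hzc)
  refine (h1.mul h2).congr_deriv ?_
  simp only [id, zero_sub, sub_zero, Complex.Gamma_one, Complex.cpow_neg_one]
  push_cast [Complex.ofReal_log hz0.le]
  field_simp

/-- The zeta expansion of `∑ e^{-nz} log n`, valid on `(0, 2π)`. -/
theorem hasSum_exp_mul_log_and_zeta_deriv {z : ℝ} (hz0 : 0 < z) (hz : z < 2 * Real.pi) :
    Summable (fun n : ℕ => Real.exp (-((n : ℝ) + 1) * z) * Real.log ((n : ℝ) + 1)) ∧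
      Summable (fun k : ℕ =>
        (-1 : ℂ) ^ k * (z : ℂ) ^ k / (k ! : ℂ) * deriv riemannZeta (-(k : ℂ))) ∧
      ((∑' n : ℕ, Real.exp (-((n : ℝ) + 1) * z) * Real.log ((n : ℝ) + 1) : ℝ) : ℂ) =
        ((-(Real.eulerMascheroniConstant + Real.log z) / z : ℝ) : ℂ) -
          ∑' k : ℕ, (-1 : ℂ) ^ k * (z : ℂ) ^ k / (k ! : ℂ) * deriv riemannZeta (-(k : ℂ)) := by
  obtain ⟨u, hu, hub⟩ := exists_summable_bound_zeta_terms hz0 hz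
  obtain ⟨v, hv, hvb⟩ := exists_summable_bound_cpow_exp hz0
  have h0 : (0 : ℂ) ∈ Metric.ball (0 : ℂ) (1 / 2) := Metric.mem_ball_self (by norm_num)
  have hL := Complex.hasSum_deriv_of_summable_norm hv
    (fun n => (differentiable_exp_mul_cpow z n).differentiableOn) Metric.isOpen_ball hvb h0
  have hR := Complex.hasSum_deriv_of_summable_norm hu
      (differentiableOn_zeta_term z) Metric.isOpen_ball hub h0
  have hRd := (Complex.differentiableOn_tsum_of_summable_norm hu
      (differentiableOn_zeta_term z) Metric.isOpen_ball hub).differentiableAt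
      (Metric.isOpen_ball.mem_nhds h0)
  have hE := ((tsum_cpow_mul_exp_eqOn hz0 hz).eventuallyEq_of_mem
    (Metric.isOpen_ball.mem_nhds h0)).deriv_eq
  rw [((hasDerivAt_Gamma_one_sub_mul_cpow hz0).fun_add hRd.hasDerivAt).deriv] at hE
  have hLt : ∀ n : ℕ, deriv
      (fun s : ℂ => (Real.exp (-((n : ℝ) + 1) * z) : ℂ) * ((n : ℂ) + 1) ^ (-s)) 0 =
      ((-(Real.exp (-((n : ℝ) + 1) * z) * Real.log ((n : ℝ) + 1)) : ℝ) : ℂ) := by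
    intro n
    have hn : (n : ℂ) + 1 ≠ 0 := by exact_mod_cast n.succ_ne_zero
    rw [(((hasDerivAt_neg (0 : ℂ)).const_cpow (c := (n : ℂ) + 1) (Or.inl hn)).const_mul _).deriv]
    push_cast [Complex.ofReal_log (show (0 : ℝ) ≤ (n : ℝ) + 1 by positivity)]
    simp
  have hRt : ∀ k : ℕ, deriv
      (fun s : ℂ => (-1 : ℂ) ^ k * (z : ℂ) ^ k / (k ! : ℂ) * riemannZeta (s - k)) 0 =
      (-1 : ℂ) ^ k * (z : ℂ) ^ k / (k ! : ℂ) * deriv riemannZeta (-(k : ℂ)) := by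
    intro k
    rw [deriv_const_mul_field, deriv_comp_sub_const, zero_sub]
  simp only [hLt] at hL
  simp only [hRt] at hR
  rw [hE, ← hR.tsum_eq] at hL
  have hLs : Summable fun n : ℕ => Real.exp (-((n : ℝ) + 1) * z) * Real.log ((n : ℝ) + 1) :=
    summable_neg_iff.1 (Complex.summable_ofReal.1 hL.summable)
  refine ⟨hLs, hR.summable, ?_⟩
  have h := hL.tsum_eq
  rw [← Complex.ofReal_tsum, tsum_neg] at h
  push_cast at h ⊢
  linear_combination -h

/-! ### Asymptotic expansion as `z → 0+`. -/

lemma isBigO_sub_sum_range_of_summable {c : ℕ → ℂ} (hc : Summable fun k => ‖c k‖)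
    (N : ℕ) :
    (fun z : ℝ => (∑' k : ℕ, (z : ℂ) ^ k * c k) - ∑ k ∈ Finset.range N, (z : ℂ) ^ k * c k)
      =O[𝓝[>] 0] fun z : ℝ => z ^ N := by
  refine IsBigO.of_bound (∑' k, ‖c (k + N)‖) ?_
  filter_upwards [self_mem_nhdsWithin, nhdsWithin_le_nhds (gt_mem_nhds one_pos)] with z hz0 hz1
  have hz0 : 0 < z := hz0
  have hcN := (summable_nat_add_iff N).2 hc
  have hs : Summable fun k : ℕ => (z : ℂ) ^ k * c k := by
    refine Summable.of_norm_bounded hc fun k => ?_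
    rw [norm_mul, norm_pow, Complex.norm_real, Real.norm_of_nonneg hz0.le]
    exact mul_le_of_le_one_left (norm_nonneg _) (pow_le_one₀ hz0.le hz1.le)
  rw [← hs.sum_add_tsum_nat_add N, add_sub_cancel_left, norm_pow, Real.norm_of_nonneg hz0.le]
  refine tsum_of_norm_bounded (hcN.hasSum.mul_right _) fun k => ?_
  rw [norm_mul, norm_pow, Complex.norm_real, Real.norm_of_nonneg hz0.le, mul_comm]
  exact mul_le_mul_of_nonneg_left (pow_le_pow_of_le_one hz0.le hz1.le (by omega)) (norm_nonneg _)

theorem mainTheorem7 :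
    -- the exact identity on `0 < z < π`, with convergence of both series
    (∀ z : ℝ, 0 < z → z < Real.pi →
      Summable (fun n : ℕ => Real.exp (-((n : ℝ) + 1) * z) * Real.log ((n : ℝ) + 1)) ∧
      Summable (fun k : ℕ =>
        (-1 : ℂ) ^ k * (z : ℂ) ^ k / (k ! : ℂ) * deriv riemannZeta (-(k : ℂ))) ∧
      ((∑' n : ℕ, Real.exp (-((n : ℝ) + 1) * z) * Real.log ((n : ℝ) + 1) : ℝ) : ℂ) =
        ((-(Real.eulerMascheroniConstant + Real.log z) / z : ℝ) : ℂ) -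
          ∑' k : ℕ, (-1 : ℂ) ^ k * (z : ℂ) ^ k / (k ! : ℂ) * deriv riemannZeta (-(k : ℂ))) ∧
    -- the right-hand side is also the asymptotic expansion as `z → 0+`
    (∀ N : ℕ,
      (fun z : ℝ =>
        ((∑' n : ℕ, Real.exp (-((n : ℝ) + 1) * z) * Real.log ((n : ℝ) + 1) : ℝ) : ℂ) -
          (((-(Real.eulerMascheroniConstant + Real.log z) / z : ℝ) : ℂ) -
            ∑ k ∈ Finset.range N,
              (-1 : ℂ) ^ k * (z : ℂ) ^ k / (k ! : ℂ) * deriv riemannZeta (-(k : ℂ))))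
        =O[𝓝[>] 0] (fun z : ℝ => z ^ N)) := by
  have hpi := Real.pi_gt_three
  refine ⟨fun z hz0 hz => hasSum_exp_mul_log_and_zeta_deriv hz0 (by linarith), fun N => ?_⟩
  -- Since `1 < 2π`, the exact expansion at `z = 1` gives absolute summability of the coefficients
  -- themselves.
  have hc := (hasSum_exp_mul_log_and_zeta_deriv one_pos (by linarith)).2.1.norm
  simp only [Complex.ofReal_one, one_pow, mul_one] at hc
  have hterm : ∀ (z : ℂ) (k : ℕ), z ^ k * ((-1 : ℂ) ^ k / (k ! : ℂ) * deriv riemannZeta (-(k : ℂ))) =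
      (-1 : ℂ) ^ k * z ^ k / (k ! : ℂ) * deriv riemannZeta (-(k : ℂ)) := fun z k => by ring
  have h := (isBigO_sub_sum_range_of_summable hc N).neg_left
  simp only [hterm] at h
  refine h.congr' ?_ EventuallyEq.rfl
  filter_upwards [self_mem_nhdsWithin, nhdsWithin_le_nhds (gt_mem_nhds one_pos)] with z hz0 hz1
  rw [(hasSum_exp_mul_log_and_zeta_deriv hz0 (by linarith)).2.2]
  ring
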